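/- **Setting.** Let $G$ be a finite group and let $S_1,S_2$ be closed connected Riemann surfaces with faithful conformal $G$-actions having the same quotient orbifold $T$, with holomorphic quotient maps $\pi_i:S_i\to T=S_i/G$ (for example, two modular companions lying over $T$). Let $\mathcal E$ be a cut system on $T$: a finite embedded graph with $k$ smooth arcs having definite tangents at their ends, meeting only at vertices and there with distinct tangent directions, whose vertex set contains all cone points, with no terminal vertex at a regular point, and whose complement is an open disc. Let $z_0\in T-\mathcal E$ and for each arc $e$ let $\delta_e$ be a simple loop at $z_0$ which meets $\mathcal E$ exactly once, transversally, at an interior point of $e$, different loops meeting only at $z_0$. Choose $x_i\in\pi_i^{-1}(z_0)$. Let $\mathcal P_i^\circ$ be the component of $\pi_i^{-1}(T-\mathcal E)$ containing $x_i$, and $\mathcal P_i^\star$ its closure with the vertices (points over vertices of $\mathcal E$) removed; let $S_i^\star$ be $S_i$ without all the vertices. For each of the $2k$ oriented arcs $e_j$ the crossover transformation $\tau_{j,i}\in G$ is the monodromy of $\delta_{e_j}$: the lift of $\delta_{e_j}$ to $S_i$ starting at $x_i$ ends at $\tau_{j,i}x_i$; opposite orientations give inverse elements. Let $H\subseteq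 G$ contain $1$ and all $\tau_{j,1}$, and let $w:H\to H'=w(H)\subseteq G$ be injective with $w(1)=1$ and $w(\tau_{j,1})=\tau_{j,2}$ for all $j$. Put $H\mathcal P_1^\star=\bigcup_{g\in H}g\mathcal P_1^\star$, and similarly $H'\mathcal P_2^\star$. We say that $w$ determines the *partial isometry* $\phi^\star:H\mathcal P_1^\star\to H'\mathcal P_2^\star$ if $\phi^\star$ is a homeomorphism, biholomorphic between the interiors, whose restriction to $g\mathcal P_1^\circ$ is $w(g)\circ\phi_0\circ g^{-1}$ for each $g\in H$, where $\phi_0=\pi_2^{-1}\circ\pi_1:\mathcal P_1^\circ\to\mathcal P_2^\circ$. It is *maximal* if no polygon $h\mathcal P_1^\star$ with $h\notin H$ that meets $H\mathcal P_1^\star$ can be added: no extension of $w$ to $H\cup\{h\}$ determines a partial isometry. It is *complete* if it is the restriction of a biholomorphic map $S_1\to S_2$. **Statement.** Let $\phi^\star$ be a maximal partial isometry determined by $w:H\to H'$. 1. $\phi^\star$ is complete if and only if $H=G$ and $w\in\mathrm{Aut}(G)$. Equivalently, $\phi^\star$ is complete if and only if $H\mathcal P_1^\star=S_1^\star$ and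 $H'\mathcal P_2^\star=S_2^\star$. 2. If $\phi^\star$ is complete, then there is a biholomorphic map $\Phi:S_1\to S_2$ extending $\phi^\star$, with $\pi_2\circ\Phi=\pi_1$, which intertwines the actions: $\Phi(gx)=w(g)\Phi(x)$ for all $g\in G$, $x\in S_1$, where $w\in\mathrm{Aut}(G)$. Moreover the Cayley graphs of the two surfaces are isomorphic: - $w$ is an isomorphism of the standard Cayley graphs of $G$ with respect to $\{\tau_{j,1}\}$ and $\{\tau_{j,2}\}$ (loops discarded); - $w$ is the vertex map of an isomorphism of the modified Cayley graphs, which have vertex set $G$, a directed edge $(e_j,g)$ from $g$ to $g\tau_{j,i}$ for each oriented arc $e_j$ and $g\in G$, and as opposite of that edge $(e_j^{op},g\tau_{j,i})$; - $\Phi$ induces an isomorphism of the dual Cayley graphs, whose vertices are the points of $\pi_i^{-1}(z_0)$ and whose edges are the lifts of the loops $\delta_{e_j}$ to $S_i$. In the last two, each edge is coloured by its arc $e$, and the isomorphism preserves colours and opposite edges. -/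

import Mathlib

open scoped Manifold ContDiff Pointwise

noncomputable section

namespace ModularCompanions

/-! ### Quotient orbifolds of conformal group actions

A closed Riemann surface is a compact connected Hausdorff space with a complex one-dimensional
manifold structure (`ChartedSpace ℂ`, `IsManifold 𝓘(ℂ) ω`); `MDifferentiable 𝓘(ℂ) 𝓘(ℂ)` means
holomorphic. An orbifold is a closed Riemann surface `T` with a function `m : T → ℕ`, the order of
each point; the cone points are the points of order different from `1`. -/

/-- `G` acts faithfully and conformally on `S`, and `π : S → T` identifies `S / G` with the
orbifold `(T, m)`. -/
structure IsOrbifoldQuotient {S T : Type*} [TopologicalSpace S] [ChartedSpace ℂ S]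
    [TopologicalSpace T] [ChartedSpace ℂ T] (G : Type*) [Group G] [MulAction G S]
    (m : T → ℕ) (π : S → T) : Prop where
  faithful : FaithfulSMul G S
  smul_holomorphic : ∀ g : G, MDifferentiable 𝓘(ℂ) 𝓘(ℂ) (fun x : S => g • x)
  holomorphic : MDifferentiable 𝓘(ℂ) 𝓘(ℂ) π
  surjective : Function.Surjective π
  fibre : ∀ x y : S, π x = π y ↔ ∃ g : G, g • x = y
  order : ∀ x : S, m (π x) = Nat.card (MulAction.stabilizer G x)

/-! ### Cut systems and crossover loops on the quotient -/

/-- The tangent vector at time `t` of a curve `c` defined on `s`, read in the preferred chart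
at `c t`. -/
def tangent {T : Type*} [TopologicalSpace T] [ChartedSpace ℂ T] (c : ℝ → T) (s : Set ℝ)
    (t : ℝ) : ℂ :=
  (mfderivWithin 𝓘(ℝ, ℝ) 𝓘(ℝ, ℂ) c s t : ℝ →L[ℝ] ℂ) 1

/-- Embedded arcs with vertices: the data of a cut system. The arc number `e` is the restriction
of `arc e` to `[0, 1]`. -/
structure ArcData (T : Type*) where
  k : ℕ
  arc : Fin k → ℝ → T
  vertices : Set T

namespace ArcData

variable {T : Type*}

/-- The underlying set of the embedded graph. -/
def graph (A : ArcData T) : Set T := A.vertices ∪ ⋃ e, A.arc e '' Set.Icc 0 1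

/-- The end point of arc `p.1`: its start if `p.2 = false`, its finish if `p.2 = true`. -/
def endpoint (A : ArcData T) (p : Fin A.k × Bool) : T := A.arc p.1 (if p.2 then 1 else 0)

/-- The tangent vector at an end of an arc, pointing from the vertex into the arc. -/
def outwardTangent [TopologicalSpace T] [ChartedSpace ℂ T] (A : ArcData T)
    (p : Fin A.k × Bool) : ℂ :=
  if p.2 then -tangent (A.arc p.1) (Set.Icc 0 1) 1 else tangent (A.arc p.1) (Set.Icc 0 1) 0

end ArcData

/-- A cut system on the orbifold `(T, m)`: a finite embedded graph whose vertex set contains all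
the cone points; smooth regular arcs with definite tangents at their ends, meeting only at
vertices and leaving each vertex in distinct directions; no regular terminal vertex; and whose
complement is an open disc. -/
structure CutSystem {T : Type*} [TopologicalSpace T] [ChartedSpace ℂ T] (m : T → ℕ)
    extends ArcData T where
  vertices_finite : vertices.Finite
  cone_mem : ∀ z : T, m z ≠ 1 → z ∈ vertices
  arc_regular : ∀ e, ContMDiffOn 𝓘(ℝ, ℝ) 𝓘(ℝ, ℂ) 1 (arc e) (Set.Icc 0 1)
  arc_smooth : ∀ e, ContMDiffOn 𝓘(ℝ, ℝ) 𝓘(ℝ, ℂ) ∞ (arc e) (Set.Ioo 0 1)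
  tangent_ne : ∀ e, ∀ t ∈ Set.Icc (0 : ℝ) 1, tangent (arc e) (Set.Icc 0 1) t ≠ 0
  endpoint_mem : ∀ p, toArcData.endpoint p ∈ vertices
  interior_notMem : ∀ e, ∀ t ∈ Set.Ioo (0 : ℝ) 1, arc e t ∉ vertices
  interior_inj : ∀ e e', ∀ t ∈ Set.Ioo (0 : ℝ) 1, ∀ t' ∈ Set.Ioo (0 : ℝ) 1,
    arc e t = arc e' t' → e = e' ∧ t = t'
  distinct_directions : ∀ p q, p ≠ q → toArcData.endpoint p = toArcData.endpoint q →
    ¬ SameRay ℝ (toArcData.outwardTangent p) (toArcData.outwardTangent q)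
  regular_not_terminal : ∀ v ∈ vertices, m v = 1 → {p | toArcData.endpoint p = v}.ncard ≠ 1
  complement_disc : Nonempty ((toArcData.graphᶜ : Set T) ≃ₜ Metric.ball (0 : ℂ) 1)

/-- A system of crossover loops for a cut system (the dual Cayley graph on the quotient): for every
arc `e` a simple loop based at the point `z₀` off the graph, which meets the graph exactly once,
transversally and at an interior point of `e`; distinct loops meet only at `z₀`. -/
structure CrossoverSystem {T : Type*} [TopologicalSpace T] [ChartedSpace ℂ T] {m : T → ℕ}
    (C : CutSystem m) (z₀ : T) where
  base_notMem : z₀ ∉ C.graph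
  loop : Fin C.k → Path z₀ z₀
  crosses : ∀ e, ∃ t : unitInterval, ∃ s ∈ Set.Ioo (0 : ℝ) 1,
    loop e t = C.arc e s ∧
    (∀ t', loop e t' ∈ C.graph ↔ t' = t) ∧
    MDifferentiableAt 𝓘(ℝ, ℝ) 𝓘(ℝ, ℂ) (loop e).extend (t : ℝ) ∧
    LinearIndependent ℝ
      ![tangent (C.arc e) (Set.Icc 0 1) s, tangent (loop e).extend Set.univ (t : ℝ)]
  simple : ∀ e, Set.InjOn (loop e) {t | t ≠ 1}
  disjoint : ∀ e e', e ≠ e' → ∀ t t', loop e t = loop e' t' → loop e t = z₀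

/-- Oriented arcs of a cut system: `(e, true)` is `e` with the orientation for which the
crossover loop is the chosen one, `(e, false)` is the opposite orientation. -/
abbrev OrientedArc {T : Type*} [TopologicalSpace T] [ChartedSpace ℂ T] {m : T → ℕ}
    (C : CutSystem m) : Type := Fin C.k × Bool

/-- The crossover loop of an oriented arc. -/
def CrossoverSystem.orientedLoop {T : Type*} [TopologicalSpace T] [ChartedSpace ℂ T] {m : T → ℕ}
    {C : CutSystem m} {z₀ : T} (D : CrossoverSystem C z₀) (j : OrientedArc C) : Path z₀ z₀ :=
  if j.2 then D.loop j.1 else (D.loop j.1).symm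

/-! ### Monodromy, crossover transformations and the tiling -/

/-- The monodromy of the loop `γ` with respect to the lift `x₀` of its base point: the `g` such
that the lift of `γ` starting at `x₀` ends at `g • x₀`. -/
def monodromy {S T : Type*} [TopologicalSpace S] [TopologicalSpace T] (G : Type*) [Group G]
    [MulAction G S] (π : S → T) (x₀ : S) {z₀ : T} (γ : Path z₀ z₀) : G :=
  Classical.epsilon fun g : G =>
    ∃ c : C(unitInterval, S), (∀ t, π (c t) = γ t) ∧ c 0 = x₀ ∧ c 1 = g • x₀

/-- The crossover transformations `τ_j`, one for each oriented arc; opposite orientations have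
inverse crossover transformations. -/
def crossover {S T : Type*} [TopologicalSpace S] [TopologicalSpace T] [ChartedSpace ℂ T]
    (G : Type*) [Group G] [MulAction G S] {m : T → ℕ} {C : CutSystem m} {z₀ : T}
    (D : CrossoverSystem C z₀) (π : S → T) (x₀ : S) (j : OrientedArc C) : G :=
  if j.2 then monodromy G π x₀ (D.loop j.1) else (monodromy G π x₀ (D.loop j.1))⁻¹

section Tiling

variable {S T : Type*} [TopologicalSpace S] [TopologicalSpace T] [ChartedSpace ℂ T] {m : T → ℕ}

/-- The distinguished open polygon `P°`: the component containing `x₀` of the preimage of the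
complement of the graph. -/
def openPolygon (C : CutSystem m) (π : S → T) (x₀ : S) : Set S :=
  connectedComponentIn (π ⁻¹' C.graphᶜ) x₀

/-- The nipped polygon `P⋆`: the closed polygon with the vertices removed. -/
def nippedPolygon (C : CutSystem m) (π : S → T) (x₀ : S) : Set S :=
  closure (openPolygon C π x₀) \ π ⁻¹' C.vertices

/-- The patch `H P⋆`, the union of the nipped polygons `g P⋆` with `g ∈ H`. -/
def patch {G : Type*} [Group G] [MulAction G S] (C : CutSystem m) (π : S → T) (x₀ : S)
    (H : Set G) : Set S :=
  ⋃ g ∈ H, g • nippedPolygon C π x₀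

/-- The surface `S⋆`: all vertices of the tiling removed. -/
def puncturedSurface (C : CutSystem m) (π : S → T) : Set S := (π ⁻¹' C.vertices)ᶜ

end Tiling

/-! ### Partial isometries -/

section PartialIsometry

variable {S₁ S₂ T : Type*} [TopologicalSpace S₁] [TopologicalSpace S₂] [TopologicalSpace T]
  [ChartedSpace ℂ S₁] [ChartedSpace ℂ S₂] [ChartedSpace ℂ T]
  {G : Type*} [Group G] [MulAction G S₁] [MulAction G S₂] {m : T → ℕ}

/-- The map `φ₀ = π₂⁻¹ ∘ π₁ : P₁° → P₂°` between the distinguished open polygons (only its values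
on `P₁°` matter). -/
def polygonMap (C : CutSystem m) (π₁ : S₁ → T) (π₂ : S₂ → T) (x₂ : S₂) (x : S₁) : S₂ :=
  haveI : Nonempty S₂ := ⟨x₂⟩
  Function.invFunOn π₂ (openPolygon C π₂ x₂) (π₁ x)

/-- `φ` is the partial isometry `H P₁⋆ → H' P₂⋆` determined by the injective assignment
`w : H → H' = w(H)`: a homeomorphism between the patches, biholomorphic between their interiors,
which on each open polygon `g P₁°`, `g ∈ H`, equals `w(g) ∘ φ₀ ∘ g⁻¹`. Only the values of `w` on `H`
and of `φ` on `H P₁⋆` matter. -/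
structure IsPartialIsometry (C : CutSystem m) (π₁ : S₁ → T) (π₂ : S₂ → T) (x₁ : S₁) (x₂ : S₂)
    (H : Set G) (w : G → G) (φ : S₁ → S₂) : Prop where
  injOn : Set.InjOn w H
  eq_on_polygons : ∀ g ∈ H, ∀ x ∈ g • openPolygon C π₁ x₁,
    φ x = w g • polygonMap C π₁ π₂ x₂ (g⁻¹ • x)
  bijOn : Set.BijOn φ (patch C π₁ x₁ H) (patch C π₂ x₂ (w '' H))
  continuousOn : ContinuousOn φ (patch C π₁ x₁ H)
  holomorphicOn : MDifferentiableOn 𝓘(ℂ) 𝓘(ℂ) φ (interior (patch C π₁ x₁ H))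
  inverse : ∃ ψ : S₂ → S₁, Set.LeftInvOn ψ φ (patch C π₁ x₁ H) ∧
    ContinuousOn ψ (patch C π₂ x₂ (w '' H)) ∧
    MDifferentiableOn 𝓘(ℂ) 𝓘(ℂ) ψ (interior (patch C π₂ x₂ (w '' H)))

/-- A partial isometry is maximal if no polygon `h P₁⋆` outside the patch `H P₁⋆` and meeting its
boundary can be added to the patch, with some value `w'(h)`, so as to still give a partial
isometry. -/
structure IsMaximalPartialIsometry (C : CutSystem m) (π₁ : S₁ → T) (π₂ : S₂ → T) (x₁ : S₁)
    (x₂ : S₂) (H : Set G) (w : G → G) (φ : S₁ → S₂) : Prop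
    extends IsPartialIsometry C π₁ π₂ x₁ x₂ H w φ where
  maximal : ∀ h ∉ H, ((h • nippedPolygon C π₁ x₁) ∩ patch C π₁ x₁ H).Nonempty →
    ∀ w' : G → G, Set.EqOn w' w H →
      ¬ ∃ φ' : S₁ → S₂, IsPartialIsometry C π₁ π₂ x₁ x₂ (insert h H) w' φ'

/-- A biholomorphic map (conformal equivalence) of Riemann surfaces. -/
def IsBiholomorphic (Φ : S₁ ≃ₜ S₂) : Prop :=
  MDifferentiable 𝓘(ℂ) 𝓘(ℂ) Φ ∧ MDifferentiable 𝓘(ℂ) 𝓘(ℂ) Φ.symm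

/-- The partial isometry `φ` on the patch `H P₁⋆` is complete: it is the restriction of a
biholomorphic map between the whole surfaces. -/
def IsCompleteIsometry (C : CutSystem m) (π₁ : S₁ → T) (x₁ : S₁) (H : Set G)
    (φ : S₁ → S₂) : Prop :=
  ∃ Φ : S₁ ≃ₜ S₂, IsBiholomorphic Φ ∧ Set.EqOn Φ φ (patch C π₁ x₁ H)

end PartialIsometry

/-! ### Cayley graphs -/

/-- A coloured multigraph, every edge of which is given by a pair of opposite directed edges. -/
structure ColouredGraph (κ V E : Type*) where
  source : E → V
  target : E → V
  op : E → E
  colour : E → κ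
  op_op : ∀ a, op (op a) = a
  source_op : ∀ a, source (op a) = target a
  colour_op : ∀ a, colour (op a) = colour a

/-- A colour-preserving isomorphism of coloured multigraphs. -/
structure ColouredGraph.Iso {κ V E V' E' : Type*} (Γ : ColouredGraph κ V E)
    (Γ' : ColouredGraph κ V' E') where
  vert : V ≃ V'
  edge : E ≃ E'
  source_edge : ∀ a, Γ'.source (edge a) = vert (Γ.source a)
  target_edge : ∀ a, Γ'.target (edge a) = vert (Γ.target a)
  op_edge : ∀ a, Γ'.op (edge a) = edge (Γ.op a)
  colour_edge : ∀ a, Γ'.colour (edge a) = Γ.colour a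

section Cayley

variable {S T : Type*} [TopologicalSpace S] [TopologicalSpace T] [ChartedSpace ℂ T]
  (G : Type*) [Group G] [MulAction G S] {m : T → ℕ} {C : CutSystem m} {z₀ : T}

/-- The standard group Cayley graph `Cay(G, Σ)` of the crossover transformations: `g` and `h ≠ g`
are adjacent if `h = g τ_j` for some oriented arc `j`. -/
def groupCayley (D : CrossoverSystem C z₀) (π : S → T) (x₀ : S) : SimpleGraph G :=
  SimpleGraph.fromRel fun g h => ∃ j, h = g * crossover G D π x₀ j

/-- The modified group Cayley graph `Cay(G, E, Σ)`: the directed edge `(j, g)` goes from `g` to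
`g τ_j`, its opposite is `(j^op, g τ_j)`, and its colour is the unoriented arc. -/
def modifiedCayley (D : CrossoverSystem C z₀) (π : S → T) (x₀ : S) :
    ColouredGraph (Fin C.k) G (OrientedArc C × G) where
  source a := a.2
  target a := a.2 * crossover G D π x₀ a.1
  op a := ((a.1.1, !a.1.2), a.2 * crossover G D π x₀ a.1)
  colour a := a.1.1
  op_op := by
    rintro ⟨⟨e, b⟩, g⟩
    cases b <;> simp [crossover]
  source_op _ := rfl
  colour_op _ := rfl

/-- The directed edges of the lift to `S` of the crossover loops: an oriented arc `j` and a lift of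
its crossover loop. -/
def LiftedEdge (D : CrossoverSystem C z₀) (π : S → T) : Type _ :=
  {p : OrientedArc C × C(unitInterval, S) // ∀ t, π (p.2 t) = D.orientedLoop p.1 t}

/-- The dual Cayley graph on `S`: the lift to `S` of the system of crossover loops. Its vertices
are the points over `z₀`, one in each open polygon; its edges are the lifts of the loops, coloured by
the arc which they cross. -/
def dualCayley (D : CrossoverSystem C z₀) (π : S → T) :
    ColouredGraph (Fin C.k) {x : S // π x = z₀} (LiftedEdge D π) where
  source a := ⟨a.1.2 0, by rw [a.2 0]; exact (D.orientedLoop a.1.1).source⟩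
  target a := ⟨a.1.2 1, by rw [a.2 1]; exact (D.orientedLoop a.1.1).target⟩
  op a := ⟨((a.1.1.1, !a.1.1.2), a.1.2.comp ⟨unitInterval.symm, unitInterval.continuous_symm⟩), by
    intro t
    obtain ⟨⟨⟨e, b⟩, c⟩, hc⟩ := a
    have h := hc (unitInterval.symm t)
    cases b <;> simpa [CrossoverSystem.orientedLoop] using h⟩
  colour a := a.1.1.1
  op_op := by
    rintro ⟨⟨⟨e, b⟩, c⟩, hc⟩
    apply Subtype.ext
    apply Prod.ext
    · simp
    · ext t
      simp
  source_op a := by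
    apply Subtype.ext
    simp
  colour_op _ := rfl

end Cayley

end ModularCompanions

end

/-!
Write `U` for the complement of the graph in `T`. Over the complement of the vertices the action of
`G` is free, so `π` is a covering there, and over the simply connected set `U` it has a section
through any given point. Hence a polygon is mapped bijectively to `U`
(`IsOrbifoldQuotient.bijOn_openPolygon`) and its translates cover the preimage of `U`. As `U` is
dense, an arc being at most one-dimensional, the polygons without their vertices fill up the
punctured surface (`IsOrbifoldQuotient.patch_univ`).

If both patches are full, the partial isometry and its inverse are holomorphic off finitely many
points and commute with the projections to `T`. Near a vertex their values stay close to a single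
point of a finite fibre, so they extend continuously, and holomorphically by the removable
singularity theorem (`IsPartialIsometry.isCompleteIsometry`).

Conversely, let `Φ` be a biholomorphic extension. By the identity theorem `π₂ ∘ Φ = π₁`, since
this holds on the distinguished polygon. For `g` in `G` the map `x ↦ Φ (g • x)` agrees with some
`a • Φ` on an open set, hence everywhere, and `g ↦ a` is an automorphism `α` of `G` which equals `w` on `H`
(`exists_mulAut_of_map_eq`). Then `Φ` restricts to a partial isometry determined by `α` on every
patch. As the punctured surface is connected, a patch with `H ≠ G` would meet a polygon outside
it, and adding this polygon would contradict maximality; so `H = G` and `w = α`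
(`IsMaximalPartialIsometry.exists_equivariant_of_complete`). The isomorphisms of Cayley graphs are
given by `α`, which matches the crossover transformations, and by `Φ`, which maps lifts of a
loop to lifts of the same loop.
-/

namespace ModularCompanions

open Set Filter Topology

/-! ### Holomorphic maps between Riemann surfaces -/

section RiemannSurface

variable {S S' : Type*} [TopologicalSpace S] [ChartedSpace ℂ S] [TopologicalSpace S']
  [ChartedSpace ℂ S']

theorem tendsto_extChartAt_symm_punctured_nhds (x : S) :
    Tendsto (extChartAt 𝓘(ℂ) x).symm (𝓝[≠] (extChartAt 𝓘(ℂ) x x)) (𝓝[≠] x) := by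
  have hx : (extChartAt 𝓘(ℂ) x).symm (extChartAt 𝓘(ℂ) x x) = x := extChartAt_to_inv x
  refine tendsto_nhdsWithin_of_tendsto_nhds_of_eventually_within _ ?_ ?_
  · have := (continuousAt_extChartAt_symm (I := 𝓘(ℂ)) x).tendsto
    rw [hx] at this
    exact this.mono_left nhdsWithin_le_nhds
  · filter_upwards [self_mem_nhdsWithin,
      nhdsWithin_le_nhds (extChartAt_target_mem_nhds (I := 𝓘(ℂ)) x)] with z hz hzt h
    rw [mem_singleton_iff] at h
    exact hz (by rw [mem_singleton_iff, ← PartialEquiv.right_inv _ hzt, h])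

theorem neBot_punctured_nhds (x : S) : (𝓝[≠] x).NeBot :=
  (tendsto_extChartAt_symm_punctured_nhds x).neBot

/-- A map that is holomorphic off `x` and continuous at `x` is analytic at `x` when read in charts. -/
theorem analyticAt_writtenInExtChartAt [IsManifold 𝓘(ℂ) ω S] [IsManifold 𝓘(ℂ) ω S']
    {f : S → S'} {x : S} (hc : ContinuousAt f x)
    (hd : ∀ᶠ y in 𝓝[≠] x, MDifferentiableAt 𝓘(ℂ) 𝓘(ℂ) f y) :
    AnalyticAt ℂ (writtenInExtChartAt 𝓘(ℂ) 𝓘(ℂ) x f) (extChartAt 𝓘(ℂ) x x) := by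
  have : IsManifold 𝓘(ℂ) 1 S := IsManifold.of_le (n := ω) le_top
  have : IsManifold 𝓘(ℂ) 1 S' := IsManifold.of_le (n := ω) le_top
  have hsymm : ContinuousAt (extChartAt 𝓘(ℂ) x).symm (extChartAt 𝓘(ℂ) x x) :=
    continuousAt_extChartAt_symm x
  have hx : (extChartAt 𝓘(ℂ) x).symm (extChartAt 𝓘(ℂ) x x) = x := extChartAt_to_inv x
  have htarget : ∀ᶠ z in 𝓝 (extChartAt 𝓘(ℂ) x x), z ∈ (extChartAt 𝓘(ℂ) x).target :=
    extChartAt_target_mem_nhds x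
  have htend := tendsto_extChartAt_symm_punctured_nhds x
  refine Complex.analyticAt_of_differentiable_on_punctured_nhds_of_continuousAt ?_ ?_
  · have hsrc : ∀ᶠ y in 𝓝[≠] x, y ∈ (chartAt ℂ x).source :=
      nhdsWithin_le_nhds (chart_source_mem_nhds ℂ x)
    have hsrc' : ∀ᶠ y in 𝓝[≠] x, f y ∈ (chartAt ℂ (f x)).source :=
      nhdsWithin_le_nhds (hc (chart_source_mem_nhds ℂ (f x)))
    filter_upwards [htend.eventually (hd.and (hsrc.and hsrc')), nhdsWithin_le_nhds htarget]
      with z ⟨h1, h2, h3⟩ h4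
    have := ((mdifferentiableAt_iff_of_mem_source (I := 𝓘(ℂ)) (I' := 𝓘(ℂ)) h2 h3).1 h1).2
    rw [PartialEquiv.right_inv _ h4] at this
    rw [ModelWithCorners.range_eq_univ, differentiableWithinAt_univ] at this
    exact this
  · have h1 : ContinuousAt f ((extChartAt 𝓘(ℂ) x).symm (extChartAt 𝓘(ℂ) x x)) := by rwa [hx]
    have h2 : ContinuousAt (extChartAt 𝓘(ℂ) (f x))
        ((f ∘ (extChartAt 𝓘(ℂ) x).symm) (extChartAt 𝓘(ℂ) x x)) := by
      rw [Function.comp_apply, hx]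
      exact continuousAt_extChartAt (f x)
    exact h2.comp (ContinuousAt.comp (g := f) h1 hsymm)

/-- Riemann's removable singularity theorem for maps between Riemann surfaces. -/
theorem mdifferentiableAt_of_punctured_nhds [IsManifold 𝓘(ℂ) ω S] [IsManifold 𝓘(ℂ) ω S']
    {f : S → S'} {x : S} (hc : ContinuousAt f x)
    (hd : ∀ᶠ y in 𝓝[≠] x, MDifferentiableAt 𝓘(ℂ) 𝓘(ℂ) f y) :
    MDifferentiableAt 𝓘(ℂ) 𝓘(ℂ) f x := by
  rw [mdifferentiableAt_iff]
  exact ⟨hc, (analyticAt_writtenInExtChartAt hc hd).differentiableAt.differentiableWithinAt⟩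

/-- The identity theorem for holomorphic maps between Riemann surfaces. -/
theorem eq_of_mdifferentiable_of_eventuallyEq [IsManifold 𝓘(ℂ) ω S] [IsManifold 𝓘(ℂ) ω S']
    [PreconnectedSpace S] [T2Space S'] {f g : S → S'} (hf : MDifferentiable 𝓘(ℂ) 𝓘(ℂ) f)
    (hg : MDifferentiable 𝓘(ℂ) 𝓘(ℂ) g) {x₀ : S} (h₀ : f =ᶠ[𝓝 x₀] g) : f = g := by
  set A : Set S := {x | f =ᶠ[𝓝 x] g} with hA
  have hopen : IsOpen A := isOpen_setOfPred_eventually_nhds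
  have hclosed : IsClosed A := by
    rw [← closure_subset_iff_isClosed]
    intro x hx
    have hfx : f x = g x := by
      have hcl : IsClosed {y | f y = g y} := isClosed_eq hf.continuous hg.continuous
      exact closure_minimal (fun y hy => hy.self_of_nhds) hcl hx
    by_contra hxA
    have hfreq : ∃ᶠ y in 𝓝[≠] x, f y = g y := by
      have h1 : ∃ᶠ y in 𝓝 x, y ∈ A := mem_closure_iff_frequently.1 hx
      rw [frequently_nhdsWithin_iff]
      refine h1.mono fun y hy => ⟨hy.self_of_nhds, ?_⟩
      rintro rfl
      exact hxA hy
    set e := extChartAt 𝓘(ℂ) x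
    have haf := analyticAt_writtenInExtChartAt (x := x) hf.continuous.continuousAt
      (Eventually.of_forall fun y => hf y)
    have hag := analyticAt_writtenInExtChartAt (x := x) hg.continuous.continuousAt
      (Eventually.of_forall fun y => hg y)
    have hsrc : ∀ᶠ y in 𝓝 x, y ∈ e.source := extChartAt_source_mem_nhds x
    have hte : Tendsto e (𝓝[≠] x) (𝓝[≠] (e x)) := by
      refine tendsto_nhdsWithin_of_tendsto_nhds_of_eventually_within _
        ((continuousAt_extChartAt x).tendsto.mono_left nhdsWithin_le_nhds) ?_
      filter_upwards [self_mem_nhdsWithin, nhdsWithin_le_nhds hsrc] with y hy hys h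
      exact hy (e.injOn hys (mem_extChartAt_source x) h)
    have hfreq' : ∃ᶠ z in 𝓝[≠] (e x), writtenInExtChartAt 𝓘(ℂ) 𝓘(ℂ) x f z =
        writtenInExtChartAt 𝓘(ℂ) 𝓘(ℂ) x g z := by
      refine hte.frequently ((hfreq.and_eventually (nhdsWithin_le_nhds hsrc)).mono ?_)
      rintro y ⟨hy, hys⟩
      simp only [writtenInExtChartAt, Function.comp_apply]
      rw [e.left_inv hys, hy, hfx]
    have hev := (haf.frequently_eq_iff_eventually_eq hag).1 hfreq'
    apply hxA
    have hft : ∀ᶠ y in 𝓝 x, f y ∈ (extChartAt 𝓘(ℂ) (f x)).source :=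
      hf.continuous.continuousAt (extChartAt_source_mem_nhds (f x))
    have hgt : ∀ᶠ y in 𝓝 x, g y ∈ (extChartAt 𝓘(ℂ) (f x)).source := by
      rw [hfx]
      exact hg.continuous.continuousAt (extChartAt_source_mem_nhds (g x))
    filter_upwards [(continuousAt_extChartAt (I := 𝓘(ℂ)) x).tendsto.eventually hev, hsrc, hft, hgt]
      with y hy hys h1 h2
    simp only [writtenInExtChartAt, Function.comp_apply] at hy
    rw [e.left_inv hys, ← hfx] at hy
    exact (extChartAt 𝓘(ℂ) (f x)).injOn h1 h2 hy
  have huniv : A = univ := IsClopen.eq_univ ⟨hclosed, hopen⟩ ⟨x₀, h₀⟩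
  funext x
  have : x ∈ A := huniv ▸ mem_univ x
  exact this.self_of_nhds

/-- A punctured disc is the image of `(0, r) × ℝ` under polar coordinates. -/
theorem isPreconnected_punctured_ball (c : ℂ) (r : ℝ) :
    IsPreconnected (Metric.ball c r \ {c}) := by
  have h : Metric.ball c r \ {c} =
      (fun p : ℝ × ℝ => c + p.1 * Complex.exp (p.2 * Complex.I)) '' (Ioo 0 r ×ˢ univ) := by
    ext z
    constructor
    · rintro ⟨hz, hzc⟩
      refine ⟨(‖z - c‖, (z - c).arg), ⟨⟨norm_pos_iff.2 (sub_ne_zero.2 hzc), ?_⟩, mem_univ _⟩, ?_⟩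
      · simpa [dist_eq_norm] using hz
      · simp only [Complex.norm_mul_exp_arg_mul_I]
        ring
    · rintro ⟨⟨ρ, θ⟩, ⟨⟨h0, hr⟩, -⟩, rfl⟩
      simp only at h0 hr
      refine ⟨?_, ?_⟩
      · simp [Complex.norm_exp_ofReal_mul_I, abs_of_pos h0, hr]
      · simp [h0.ne']
  rw [h]
  refine (isPreconnected_Ioo.prod isPreconnected_univ).image _ ?_
  fun_prop

/-- Every neighbourhood of a point of a Riemann surface contains a connected punctured
neighbourhood. -/
theorem exists_isPreconnected_punctured_nhds {x : S} {N : Set S} (hN : N ∈ 𝓝[≠] x) :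
    ∃ D ∈ 𝓝[≠] x, D ⊆ N ∧ IsPreconnected D := by
  set e := chartAt ℂ x
  have hxs : x ∈ e.source := mem_chart_source ℂ x
  have hxt : e x ∈ e.target := mem_chart_target ℂ x
  obtain ⟨O, hO, hON⟩ : ∃ O ∈ 𝓝 x, O ∩ {x}ᶜ ⊆ N := by
    rw [mem_nhdsWithin_iff_exists_mem_nhds_inter] at hN
    exact hN
  have h1 : e.symm ⁻¹' O ∈ 𝓝 (e x) := by
    apply (e.continuousAt_symm hxt)
    rwa [e.left_inv hxs]
  obtain ⟨r, hr, hball⟩ := Metric.mem_nhds_iff.1 (inter_mem h1 (e.open_target.mem_nhds hxt))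
  refine ⟨e.symm '' (Metric.ball (e x) r \ {e x}), ?_, ?_, ?_⟩
  · have h2 : ∀ᶠ y in 𝓝 x, y ∈ e.source ∧ e y ∈ Metric.ball (e x) r :=
      Filter.Eventually.and (e.open_source.mem_nhds hxs)
        ((e.continuousAt hxs) (Metric.ball_mem_nhds _ hr))
    filter_upwards [self_mem_nhdsWithin, nhdsWithin_le_nhds h2] with y hy ⟨hys, hyb⟩
    exact ⟨e y, ⟨hyb, fun h => hy (e.injOn hys hxs h)⟩, e.left_inv hys⟩
  · rintro _ ⟨z, ⟨hz, hzx⟩, rfl⟩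
    refine hON ⟨(hball hz).1, fun h => hzx ?_⟩
    rw [mem_singleton_iff] at h ⊢
    rw [← h, e.right_inv (hball hz).2]
  · exact (isPreconnected_punctured_ball _ _).image _
      (e.continuousOn_symm.mono fun z hz => (hball hz.1).2)

omit [ChartedSpace ℂ S] in
theorem compl_mem_punctured_nhds_of_finite [T1Space S] {F : Set S} (hF : F.Finite) (x : S) :
    Fᶜ ∈ 𝓝[≠] x := by
  have h1 : (F \ {x})ᶜ ∈ 𝓝 x :=
    (hF.subset sdiff_subset).isClosed.isOpen_compl.mem_nhds fun h => h.2 rfl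
  filter_upwards [self_mem_nhdsWithin, nhdsWithin_le_nhds h1] with y hy hy' hyF
  exact hy' ⟨hyF, hy⟩

/-- Deleting finitely many points does not disconnect a Riemann surface. -/
theorem isPreconnected_compl_of_finite [PreconnectedSpace S] [T2Space S] {F : Set S}
    (hF : F.Finite) : IsPreconnected Fᶜ := by
  intro u v hu hv hsub hFu hFv
  by_contra hne
  have hdisj : ∀ y ∈ Fᶜ, y ∈ u → y ∉ v := fun y hy hyu hyv => hne ⟨y, hy, hyu, hyv⟩
  have hFo : IsOpen Fᶜ := hF.isClosed.isOpen_compl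
  have hpunct : ∀ x, Fᶜ ∈ 𝓝[≠] x := compl_mem_punctured_nhds_of_finite hF
  -- A connected punctured neighbourhood lies on one side, so the closures of the sides are disjoint.
  have key : ∀ a b : Set S, IsOpen a → IsOpen b → (∀ y ∈ Fᶜ, y ∈ a → y ∉ b) → ∀ x,
      x ∈ closure (Fᶜ ∩ b) → ∀ D ∈ 𝓝[≠] x, D ⊆ Fᶜ → ¬ D ⊆ a := by
    intro a b ha hb hab x hx D hD hDF hDa
    obtain ⟨y, hy, hyF, hyb⟩ := mem_closure_iff_nhds.1 hx _ (insert_mem_nhds_iff.2 hD)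
    have hDb : ∀ y ∈ D, y ∉ b := fun y hy => hab y (hDF hy) (hDa hy)
    rcases hy with rfl | hy
    · have : Fᶜ ∩ b ∈ 𝓝[≠] y := nhdsWithin_le_nhds ((hFo.inter hb).mem_nhds ⟨hyF, hyb⟩)
      have hn := neBot_punctured_nhds y
      obtain ⟨z, hz, hz'⟩ := hn.nonempty_of_mem (inter_mem this hD)
      exact hDb z hz' hz.2
    · exact hDb y hy hyb
  have hdense : Dense Fᶜ := by
    intro x
    rw [mem_closure_iff_nhds]
    intro t ht
    have hn := neBot_punctured_nhds x
    exact hn.nonempty_of_mem (inter_mem (nhdsWithin_le_nhds ht) (hpunct x))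
  have hcover : (univ : Set S) ⊆ closure (Fᶜ ∩ u) ∪ closure (Fᶜ ∩ v) := by
    rw [← closure_union, ← inter_union_distrib_left, inter_eq_left.2 hsub, hdense.closure_eq]
  obtain ⟨x, -, hxu, hxv⟩ := isPreconnected_closed_iff.1 (isPreconnected_univ (α := S)) _ _
    isClosed_closure isClosed_closure hcover
    (hFu.mono fun y hy => ⟨mem_univ y, subset_closure hy⟩)
    (hFv.mono fun y hy => ⟨mem_univ y, subset_closure hy⟩)
  obtain ⟨D, hD, hDF, hDc⟩ := exists_isPreconnected_punctured_nhds (hpunct x)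
  have hside := isPreconnected_iff_subset_of_disjoint.1 hDc u v hu hv (hDF.trans hsub)
    (eq_empty_of_forall_notMem fun y hy => hdisj y (hDF hy.1) hy.2.1 hy.2.2)
  rcases hside with h | h
  · exact key u v hu hv hdisj x hxv D hD hDF h
  · exact key v u hv hu (fun y hy h1 h2 => hdisj y hy h2 h1) x hxu D hD hDF h

end RiemannSurface

/-! ### The complement of the graph of a cut system -/

section CutSystem

variable {T : Type*} [TopologicalSpace T] [ChartedSpace ℂ T] {m : T → ℕ}

theorem CutSystem.isCompact_arc (C : CutSystem m) (e : Fin C.k) :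
    IsCompact (C.arc e '' Icc 0 1) :=
  isCompact_Icc.image_of_continuousOn (C.arc_regular e).continuousOn

theorem CutSystem.isClosed_graph [T2Space T] (C : CutSystem m) : IsClosed C.graph :=
  C.vertices_finite.isClosed.union (isClosed_iUnion_of_finite fun e => (C.isCompact_arc e).isClosed)

/-- An arc has Hausdorff dimension at most one in every chart, so it has no interior point. -/
theorem CutSystem.dense_compl_arc [IsManifold 𝓘(ℂ) ω T] (C : CutSystem m) (e : Fin C.k) :
    Dense (C.arc e '' Icc 0 1)ᶜ := by
  rw [← interior_eq_empty_iff_dense_compl, eq_empty_iff_forall_notMem]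
  intro z hz
  set c := chartAt ℂ z
  set A := Icc (0 : ℝ) 1 ∩ C.arc e ⁻¹' c.source
  have hlip : ∀ t ∈ A, ∃ K, ∃ u ∈ 𝓝[A] t, LipschitzOnWith K (c ∘ C.arc e) u := by
    rintro t ⟨ht, hts⟩
    have h1 := C.arc_regular e t ht
    have h2 : ContMDiffAt 𝓘(ℝ, ℂ) 𝓘(ℝ, ℂ) 1 c (C.arc e t) := by
      -- The real smoothness of `c` comes from the complex coordinate changes.
      refine contMDiffAt_iff.2 ⟨c.continuousAt hts, ?_⟩
      have h := contDiffWithinAt_ext_coord_change (I := 𝓘(ℂ)) (n := ω) z (C.arc e t)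
        (y := extChartAt 𝓘(ℂ) (C.arc e t) (C.arc e t)) ⟨mem_extChartAt_target _, by
          simpa using hts⟩
      have h' := (h.restrict_scalars ℝ).of_le (m := 1) le_top
      simpa [chartAt_self_eq] using h'
    have h3 := (h2.comp_contMDiffWithinAt t h1).contDiffWithinAt
    obtain ⟨K, u, hu, hK⟩ := h3.exists_lipschitzOnWith (convex_Icc 0 1)
    exact ⟨K, u, nhdsWithin_mono _ inter_subset_left hu, hK⟩
  have hdim : dimH ((c ∘ C.arc e) '' A) ≤ 1 :=
    (dimH_image_le_of_locally_lipschitzOn hlip).trans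
      ((dimH_mono (subset_univ A)).trans Real.dimH_univ.le)
  have hint : (interior ((c ∘ C.arc e) '' A)).Nonempty := by
    have hopen : IsOpen (c '' (c.source ∩ interior (C.arc e '' Icc 0 1))) :=
      c.isOpen_image_source_inter isOpen_interior
    refine ⟨c z, interior_maximal ?_ hopen ⟨z, ⟨mem_chart_source ℂ z, hz⟩, rfl⟩⟩
    rintro _ ⟨y, ⟨hys, hy⟩, rfl⟩
    obtain ⟨t, ht, rfl⟩ := interior_subset hy
    exact ⟨t, ⟨ht, hys⟩, rfl⟩
  rw [Real.dimH_of_nonempty_interior hint, Complex.finrank_real_complex] at hdim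
  exact absurd hdim (by norm_num)

theorem CutSystem.dense_compl_graph [T2Space T] [IsManifold 𝓘(ℂ) ω T] (C : CutSystem m) :
    Dense C.graphᶜ := by
  have hV : Dense C.verticesᶜ := by
    have hn := fun x : T => neBot_punctured_nhds x
    rw [compl_eq_univ_sdiff]
    exact dense_univ.sdiff_finite C.vertices_finite
  have hA : Dense (⋂ e, (C.arc e '' Icc 0 1)ᶜ) := by
    have hfin : ∀ s : Finset (Fin C.k), Dense (⋂ e ∈ s, (C.arc e '' Icc 0 1)ᶜ) := by
      intro s
      induction s using Finset.induction_on with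
      | empty => simp
      | insert e s _ ih =>
        rw [Finset.set_biInter_insert]
        exact (C.dense_compl_arc e).inter_of_isOpen_left ih
          (C.isCompact_arc e).isClosed.isOpen_compl
    simpa using hfin Finset.univ
  rw [ArcData.graph, compl_union, compl_iUnion]
  exact hV.inter_of_isOpen_left hA C.vertices_finite.isClosed.isOpen_compl

end CutSystem

/-! ### The polygons of the tiling -/

section PolygonInclusions

variable {S T G : Type*} [TopologicalSpace S] [TopologicalSpace T] [ChartedSpace ℂ T] [Group G]
  [MulAction G S] {m : T → ℕ} {π : S → T}

theorem mem_openPolygon_self (C : CutSystem m) {x₀ : S} (hx₀ : π x₀ ∉ C.graph) :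
    x₀ ∈ openPolygon C π x₀ := mem_connectedComponentIn hx₀

theorem openPolygon_subset (C : CutSystem m) (x₀ : S) :
    openPolygon C π x₀ ⊆ π ⁻¹' C.graphᶜ := connectedComponentIn_subset _ _

theorem smul_openPolygon_subset_smul_nippedPolygon (C : CutSystem m) (x₀ : S) (g : G) :
    g • openPolygon C π x₀ ⊆ g • nippedPolygon C π x₀ :=
  smul_set_mono fun _ hx => ⟨subset_closure hx, fun h => openPolygon_subset C x₀ hx (Or.inl h)⟩

theorem smul_openPolygon_subset_patch (C : CutSystem m) (x₀ : S) {H : Set G} {g : G}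
    (hg : g ∈ H) : g • openPolygon C π x₀ ⊆ patch C π x₀ H :=
  
  fun _ hx => mem_biUnion hg (smul_openPolygon_subset_smul_nippedPolygon C x₀ g hx)

end PolygonInclusions

section Polygons

variable {S T G : Type*} [TopologicalSpace S] [ChartedSpace ℂ S] [TopologicalSpace T]
  [ChartedSpace ℂ T] [Group G] [MulAction G S] {m : T → ℕ} {π : S → T}

namespace IsOrbifoldQuotient

variable (hπ : IsOrbifoldQuotient G m π)
include hπ

theorem continuous : Continuous π := hπ.holomorphic.continuous

theorem continuousConstSMul : ContinuousConstSMul G S :=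
  ⟨fun g => (hπ.smul_holomorphic g).continuous⟩

theorem map_smul (g : G) (x : S) : π (g • x) = π x :=
  ((hπ.fibre x (g • x)).2 ⟨g, rfl⟩).symm

theorem isQuotientMap [CompactSpace S] [T2Space T] : Topology.IsQuotientMap π :=
  hπ.continuous.isClosedMap.isQuotientMap hπ.continuous hπ.surjective

theorem isOpenMap [CompactSpace S] [T2Space T] : IsOpenMap π := by
  intro U hU
  have := hπ.continuousConstSMul
  rw [← hπ.isQuotientMap.isOpen_preimage]
  have h : π ⁻¹' (π '' U) = ⋃ g : G, g • U := by
    ext x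
    simp only [mem_preimage, mem_image, mem_iUnion, mem_smul_set, hπ.fibre]
    exact ⟨fun ⟨y, hy, g, h⟩ => ⟨g, y, hy, h⟩, fun ⟨g, y, hy, h⟩ => ⟨y, hy, g, h⟩⟩
  rw [h]
  exact isOpen_iUnion fun g => hU.smul g

theorem finite_fibre [Finite G] (z : T) : (π ⁻¹' {z}).Finite := by
  obtain ⟨x, rfl⟩ := hπ.surjective z
  refine (finite_range fun g : G => g • x).subset ?_
  intro y hy
  exact (hπ.fibre x y).1 (mem_singleton_iff.1 hy).symm

theorem stabilizer_eq_bot [Finite G] (C : CutSystem m) {x : S} (hx : π x ∉ C.vertices) :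
    MulAction.stabilizer G x = ⊥ := by
  have h1 : m (π x) = 1 := by
    by_contra h
    exact hx (C.cone_mem _ h)
  rw [hπ.order] at h1
  exact Subgroup.card_eq_one.1 h1

/-- The action is free over the complement of the vertices. -/
theorem smul_right_injective [Finite G] (C : CutSystem m) {x : S} (hx : π x ∉ C.vertices) :
    Function.Injective fun g : G => g • x := by
  intro g h hgh
  simp only at hgh
  have h1 : g⁻¹ * h ∈ MulAction.stabilizer G x := by
    rw [MulAction.mem_stabilizer_iff, mul_smul, ← hgh, inv_smul_smul]
  rw [hπ.stabilizer_eq_bot C hx, Subgroup.mem_bot, inv_mul_eq_one] at h1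
  exact h1

/-- The quotient map has a section over the simply connected complement of the graph, through any
prescribed point. -/
theorem exists_section [Finite G] [CompactSpace S] [T2Space S] [T2Space T] (C : CutSystem m)
    {x₀ : S} (hx₀ : π x₀ ∉ C.graph) :
    ∃ s : C((C.graphᶜ : Set T), S), s ⟨π x₀, hx₀⟩ = x₀ ∧ ∀ z, π (s z) = z := by
  have := hπ.continuousConstSMul
  obtain ⟨e⟩ := C.complement_disc
  have hcov := hπ.isQuotientMap.isCoveringMapOn_of_properlyDiscontinuousSMul (G := G)
    fun {x y} => by
      rw [eq_comm, hπ.fibre]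
      exact Iff.rfl
  have : ContractibleSpace (Metric.ball (0 : ℂ) 1) :=
    (convex_ball (0 : ℂ) 1).contractibleSpace (Metric.nonempty_ball.2 one_pos)
  have : LocallyPathConnectedSpace (Metric.ball (0 : ℂ) 1) :=
    Metric.isOpen_ball.locallyPathConnectedSpace
  obtain ⟨F, ⟨hF₀, hF⟩, -⟩ := hcov.existsUnique_continuousMap_lifts
    (⟨fun a => (e.symm a : T), by fun_prop⟩ : C(Metric.ball (0 : ℂ) 1, T))
    (a₀ := e ⟨π x₀, hx₀⟩) (e₀ := x₀) (by simp) (by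
      intro a
      obtain ⟨x, hx⟩ := hπ.surjective (e.symm a)
      exact ⟨x, hπ.stabilizer_eq_bot C fun h => (e.symm a).2 (Or.inl (hx ▸ h)), hx⟩)
  refine ⟨F.comp ⟨e, e.continuous⟩, hF₀, fun z => ?_⟩
  have := congrFun hF (e z)
  simpa using this

/-- A polygon is the image of a section, because that image is open and closed in the preimage of
the complement of the graph. -/
theorem exists_section_range_eq [Finite G] [CompactSpace S] [T2Space S] [T2Space T]
    (C : CutSystem m) {x₀ : S} (hx₀ : π x₀ ∉ C.graph) :
    ∃ s : C((C.graphᶜ : Set T), S), s ⟨π x₀, hx₀⟩ = x₀ ∧ (∀ z, π (s z) = z) ∧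
      openPolygon C π x₀ = range s := by
  have := hπ.continuousConstSMul
  obtain ⟨s, hs₀, hs⟩ := hπ.exists_section C hx₀
  refine ⟨s, hs₀, hs, ?_⟩
  have hx₀' : x₀ ∈ π ⁻¹' C.graphᶜ := hx₀
  obtain ⟨e⟩ := C.complement_disc
  have : PreconnectedSpace (Metric.ball (0 : ℂ) 1) :=
    isPreconnected_iff_preconnectedSpace.1 (convex_ball (0 : ℂ) 1).isPreconnected
  have : PreconnectedSpace (C.graphᶜ : Set T) := by
    have := e.symm.surjective.denseRange.preconnectedSpace e.symm.continuous
    exact this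
  apply Subset.antisymm
  · -- The image of `s` is the locus `s (q x) = x`. Its translates are closed, and as the action is
    -- free they partition the preimage, so each of them is also open.
    set q : (π ⁻¹' C.graphᶜ : Set S) → (C.graphᶜ : Set T) := fun x => ⟨π x, x.2⟩ with hq
    have hqc : Continuous q := (hπ.continuous.comp continuous_subtype_val).subtype_mk _
    have hclosed : ∀ g : G, IsClosed {x | g • s (q x) = (x : S)} := fun g =>
      isClosed_eq ((s.continuous.comp hqc).const_smul g) continuous_subtype_val
    have hcompl : {x | (1 : G) • s (q x) = (x : S)} =
        (⋃ g : {g : G // g ≠ 1}, {x | (g : G) • s (q x) = (x : S)})ᶜ := by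
      ext x
      simp only [mem_ofPred_eq, mem_compl_iff, mem_iUnion, not_exists]
      have hsv : π (s (q x)) ∉ C.vertices := by
        rw [hs]
        exact fun h => (q x).2 (Or.inl h)
      constructor
      · intro h g hg
        exact g.2 (hπ.smul_right_injective C hsv (hg.trans h.symm))
      · intro h
        obtain ⟨g, hg⟩ := (hπ.fibre (s (q x)) x).1 (by rw [hs])
        by_cases hg1 : g = 1
        · rw [← hg1, hg]
        · exact absurd hg (h ⟨g, hg1⟩)
    have hclopen : IsClopen {x | (1 : G) • s (q x) = (x : S)} := by
      refine ⟨hclosed 1, ?_⟩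
      rw [hcompl]
      exact (isClosed_iUnion_of_finite fun g => hclosed _).isOpen_compl
    intro x hx
    have hxm : x ∈ π ⁻¹' C.graphᶜ := connectedComponentIn_subset _ _ hx
    rw [openPolygon, connectedComponentIn_eq_image hx₀'] at hx
    obtain ⟨y, hy, rfl⟩ := hx
    have := hclopen.connectedComponent_subset (x := ⟨x₀, hx₀'⟩) (by
      simp only [mem_ofPred_eq, one_smul]
      exact hs₀) hy
    simp only [mem_ofPred_eq, one_smul] at this
    exact ⟨q y, this⟩
  · refine IsPreconnected.subset_connectedComponentIn (isPreconnected_range s.continuous)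
      ⟨_, hs₀⟩ ?_
    rintro _ ⟨z, rfl⟩
    rw [mem_preimage, hs]
    exact z.2

theorem bijOn_openPolygon [Finite G] [CompactSpace S] [T2Space S] [T2Space T] (C : CutSystem m)
    {x₀ : S} (hx₀ : π x₀ ∉ C.graph) : BijOn π (openPolygon C π x₀) C.graphᶜ := by
  obtain ⟨s, -, hs, hr⟩ := hπ.exists_section_range_eq C hx₀
  refine ⟨openPolygon_subset C x₀, ?_, ?_⟩
  · rw [hr]
    rintro _ ⟨z, rfl⟩ _ ⟨z', rfl⟩ h
    rw [hs, hs] at h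
    rw [Subtype.ext h]
  · intro z hz
    exact ⟨s ⟨z, hz⟩, hr ▸ mem_range_self _, hs _⟩

theorem isOpen_openPolygon [T2Space T] (C : CutSystem m) (x₀ : S) :
    IsOpen (openPolygon C π x₀) := by
  have : LocallyConnectedSpace S := ChartedSpace.locallyConnectedSpace ℂ S
  exact (C.isClosed_graph.isOpen_compl.preimage hπ.continuous).connectedComponentIn

/-- The translates of the distinguished polygon cover the preimage of the complement of the
graph. -/
theorem iUnion_smul_openPolygon [Finite G] [CompactSpace S] [T2Space S] [T2Space T]
    (C : CutSystem m) {x₀ : S} (hx₀ : π x₀ ∉ C.graph) :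
    ⋃ g : G, g • openPolygon C π x₀ = π ⁻¹' C.graphᶜ := by
  apply Subset.antisymm
  · refine iUnion_subset fun g => ?_
    rintro _ ⟨x, hx, rfl⟩
    simpa only [mem_preimage, hπ.map_smul] using openPolygon_subset C x₀ hx
  · intro x hx
    obtain ⟨y, hy, hyx⟩ := (hπ.bijOn_openPolygon C hx₀).surjOn hx
    obtain ⟨g, rfl⟩ := (hπ.fibre y x).1 hyx
    exact mem_iUnion.2 ⟨g, smul_mem_smul_set hy⟩

theorem dense_preimage_compl_graph [CompactSpace S] [T2Space T] [IsManifold 𝓘(ℂ) ω T]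
    (C : CutSystem m) : Dense (π ⁻¹' C.graphᶜ) :=
  C.dense_compl_graph.preimage hπ.isOpenMap

theorem dense_puncturedSurface [CompactSpace S] [T2Space T] [IsManifold 𝓘(ℂ) ω T]
    (C : CutSystem m) : Dense (puncturedSurface C π) :=
  (hπ.dense_preimage_compl_graph C).mono fun _ hx h => (show _ ∉ C.graph from hx) (Or.inl h)

theorem finite_preimage_vertices [Finite G] (C : CutSystem m) : (π ⁻¹' C.vertices).Finite := by
  rw [← biUnion_preimage_singleton]
  exact C.vertices_finite.biUnion fun z _ => hπ.finite_fibre z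

theorem isOpen_puncturedSurface [T2Space T] (C : CutSystem m) : IsOpen (puncturedSurface C π) :=
  (C.vertices_finite.isClosed.preimage hπ.continuous).isOpen_compl

theorem smul_nippedPolygon (C : CutSystem m) (x₀ : S) (g : G) :
    g • nippedPolygon C π x₀ = closure (g • openPolygon C π x₀) \ π ⁻¹' C.vertices := by
  have := hπ.continuousConstSMul
  have h : g • (π ⁻¹' C.vertices) = π ⁻¹' C.vertices := by
    ext x
    rw [mem_smul_set_iff_inv_smul_mem, mem_preimage, mem_preimage, hπ.map_smul]
  rw [nippedPolygon, smul_set_sdiff, h, closure_smul]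

/-- A patch is closed in the punctured surface. -/
theorem patch_eq [Finite G] (C : CutSystem m) (x₀ : S) (H : Set G) :
    patch C π x₀ H = closure (⋃ g ∈ H, g • openPolygon C π x₀) ∩ puncturedSurface C π := by
  rw [H.toFinite.closure_biUnion, patch, puncturedSurface, ← sdiff_eq]
  simp only [hπ.smul_nippedPolygon, iUnion_sdiff]

/-- The polygons with their vertices removed fill up the punctured surface. -/
theorem patch_univ [Finite G] [CompactSpace S] [T2Space S] [T2Space T] [IsManifold 𝓘(ℂ) ω T]
    (C : CutSystem m) {x₀ : S} (hx₀ : π x₀ ∉ C.graph) :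
    patch C π x₀ (univ : Set G) = puncturedSurface C π := by
  rw [hπ.patch_eq, biUnion_univ, hπ.iUnion_smul_openPolygon C hx₀,
    (hπ.dense_preimage_compl_graph C).closure_eq, univ_inter]

end IsOrbifoldQuotient

end Polygons

/-! ### Extension over the vertices -/

/-- A lift `f` of `q` through a map `p` with compact domain has a limit at `v` when the fibre of `p`
over `q v` is finite: the values of `f` on a small connected neighbourhood stay near one point of
the fibre. -/
theorem exists_tendsto_of_finite_fibre {S X T : Type*} [TopologicalSpace S] [TopologicalSpace X]
    [CompactSpace X] [T2Space X] [TopologicalSpace T] [T2Space T] {f : S → X} {p : X → T}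
    {q : S → T} {A : Set S} {v : S} [(𝓝[A] v).NeBot] (hp : Continuous p) (hq : ContinuousAt q v)
    (hfin : (p ⁻¹' {q v}).Finite) (hf : ContinuousOn f A) (hfq : ∀ x ∈ A, p (f x) = q x)
    (hA : ∀ N ∈ 𝓝[A] v, ∃ D ∈ 𝓝[A] v, D ⊆ N ∧ IsPreconnected D) :
    ∃ y, Tendsto f (𝓝[A] v) (𝓝 y) := by
  have key : ∀ O : Set X, IsOpen O → p ⁻¹' {q v} ⊆ O → ∀ᶠ x in 𝓝[A] v, f x ∈ O := by
    intro O hO hsub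
    have hcl : IsClosed (p '' Oᶜ) := hp.isClosedMap _ hO.isClosed_compl
    have hv : q v ∉ p '' Oᶜ := by
      rintro ⟨y, hy, hyv⟩
      exact hy (hsub hyv)
    have h1 : ∀ᶠ x in 𝓝 v, q x ∈ (p '' Oᶜ)ᶜ := hq (hcl.isOpen_compl.mem_nhds hv)
    filter_upwards [nhdsWithin_le_nhds h1, self_mem_nhdsWithin] with x hx hxA
    by_contra hfx
    exact hx ⟨f x, hfx, hfq x hxA⟩
  obtain ⟨U, hU, hdisj⟩ := hfin.t2_separation
  have hcov : p ⁻¹' {q v} ⊆ ⋃ y ∈ p ⁻¹' {q v}, U y := fun y hy => mem_biUnion hy (hU y).1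
  obtain ⟨D, hD, hDsub, hDc⟩ := hA _ (inter_mem
    (key _ (isOpen_biUnion fun y _ => (hU y).2) hcov) self_mem_nhdsWithin)
  obtain ⟨x, hx⟩ := (inferInstance : (𝓝[A] v).NeBot).nonempty_of_mem hD
  obtain ⟨y, hy, hxy⟩ := mem_iUnion₂.1 (hDsub hx).1
  set W := ⋃ z ∈ p ⁻¹' {q v} \ {y}, U z with hW
  have hWo : IsOpen W := isOpen_biUnion fun z _ => (hU z).2
  have hUW : Disjoint (U y) W := by
    rw [hW, disjoint_iUnion₂_right]
    exact fun z hz => hdisj hy hz.1 fun h => hz.2 h.symm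
  have hDU : f '' D ⊆ U y := by
    refine IsPreconnected.subset_left_of_subset_union (hU y).2 hWo hUW ?_
      ⟨f x, mem_image_of_mem f hx, hxy⟩ (hDc.image f (hf.mono fun z hz => (hDsub hz).2))
    rintro _ ⟨z, hz, rfl⟩
    obtain ⟨y', hy', hzy'⟩ := mem_iUnion₂.1 (hDsub hz).1
    by_cases h : y' = y
    · exact Or.inl (h ▸ hzy')
    · exact Or.inr (mem_biUnion ⟨hy', h⟩ hzy')
  refine ⟨y, tendsto_nhds.2 fun O hO hyO => ?_⟩
  have h1 := key (O ∪ W) (hO.union hWo) fun z hz => by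
    by_cases h : z = y
    · exact Or.inl (h ▸ hyO)
    · exact Or.inr (mem_biUnion ⟨hz, h⟩ (hU z).1)
  filter_upwards [h1, hD] with z hz hzD
  exact hz.resolve_right fun h => hUW.notMem_of_mem_left (hDU (mem_image_of_mem f hzD)) h

section PolygonMap

variable {G S₁ S₂ T : Type*} [Group G] [Finite G] [TopologicalSpace S₂] [T2Space S₂]
  [CompactSpace S₂] [ChartedSpace ℂ S₂] [MulAction G S₂] [TopologicalSpace T] [T2Space T]
  [ChartedSpace ℂ T] {m : T → ℕ} {π₁ : S₁ → T} {π₂ : S₂ → T} {C : CutSystem m} {x₂ : S₂}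

theorem polygonMap_mem (hπ₂ : IsOrbifoldQuotient G m π₂) (hx₂ : π₂ x₂ ∉ C.graph) {x : S₁}
    (hx : π₁ x ∉ C.graph) : polygonMap C π₁ π₂ x₂ x ∈ openPolygon C π₂ x₂ :=
  have : Nonempty S₂ := ⟨x₂⟩
  Function.invFunOn_mem ((hπ₂.bijOn_openPolygon C hx₂).surjOn hx)

theorem map_polygonMap (hπ₂ : IsOrbifoldQuotient G m π₂) (hx₂ : π₂ x₂ ∉ C.graph) {x : S₁}
    (hx : π₁ x ∉ C.graph) : π₂ (polygonMap C π₁ π₂ x₂ x) = π₁ x :=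
  have : Nonempty S₂ := ⟨x₂⟩
  Function.invFunOn_eq ((hπ₂.bijOn_openPolygon C hx₂).surjOn hx)

theorem polygonMap_eq (hπ₂ : IsOrbifoldQuotient G m π₂) (hx₂ : π₂ x₂ ∉ C.graph) {x : S₁} {y : S₂}
    (hy : y ∈ openPolygon C π₂ x₂) (hxy : π₂ y = π₁ x) : polygonMap C π₁ π₂ x₂ x = y := by
  have hx : π₁ x ∉ C.graph := hxy ▸ openPolygon_subset C x₂ hy
  exact (hπ₂.bijOn_openPolygon C hx₂).injOn (polygonMap_mem hπ₂ hx₂ hx) hy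
    ((map_polygonMap hπ₂ hx₂ hx).trans hxy.symm)

end PolygonMap

section TwoSurfaces

variable {G S₁ S₂ T : Type*} [Group G] [Finite G]
  [TopologicalSpace S₁] [T2Space S₁] [CompactSpace S₁]
  [ChartedSpace ℂ S₁] [IsManifold 𝓘(ℂ) ω S₁] [MulAction G S₁]
  [TopologicalSpace S₂] [T2Space S₂] [CompactSpace S₂]
  [ChartedSpace ℂ S₂] [IsManifold 𝓘(ℂ) ω S₂] [MulAction G S₂]
  [TopologicalSpace T] [T2Space T] [ChartedSpace ℂ T] [IsManifold 𝓘(ℂ) ω T]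
  {m : T → ℕ} {π₁ : S₁ → T} {π₂ : S₂ → T} {C : CutSystem m}

/-- A holomorphic lift of `π₁` through `π₂`, defined off the vertices, extends holomorphically to
the vertices. -/
theorem IsOrbifoldQuotient.exists_holomorphic_extension (hπ₁ : IsOrbifoldQuotient G m π₁)
    (hπ₂ : IsOrbifoldQuotient G m π₂) {f : S₁ → S₂}
    (hf : MDifferentiableOn 𝓘(ℂ) 𝓘(ℂ) f (puncturedSurface C π₁))
    (hfπ : ∀ x ∈ puncturedSurface C π₁, π₂ (f x) = π₁ x) :
    ∃ Φ : S₁ → S₂, MDifferentiable 𝓘(ℂ) 𝓘(ℂ) Φ ∧ EqOn Φ f (puncturedSurface C π₁) := by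
  set A := puncturedSurface C π₁ with hA
  have hAo : IsOpen A := hπ₁.isOpen_puncturedSurface C
  have hAd : Dense A := hπ₁.dense_puncturedSurface C
  have hAp : ∀ x, A ∈ 𝓝[≠] x := compl_mem_punctured_nhds_of_finite (hπ₁.finite_preimage_vertices C)
  have hlim : ∀ x, ∃ y, Tendsto f (𝓝[A] x) (𝓝 y) := by
    intro v
    by_cases hv : v ∈ A
    · exact ⟨f v, hf.continuousOn v hv⟩
    · have hnhds : 𝓝[A] v = 𝓝[≠] v := by
        apply le_antisymm
        · exact nhdsWithin_mono _ fun x hx h => hv (mem_singleton_iff.1 h ▸ hx)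
        · exact nhdsWithin_le_of_mem (hAp v)
      have : (𝓝[A] v).NeBot := hnhds ▸ neBot_punctured_nhds v
      refine exists_tendsto_of_finite_fibre hπ₂.continuous hπ₁.continuous.continuousAt
        (hπ₂.finite_fibre (π₁ v)) hf.continuousOn hfπ ?_
      rw [hnhds]
      exact fun N hN => exists_isPreconnected_punctured_nhds hN
  have hext : EqOn (extendFrom A f) f A := fun x hx =>
    extendFrom_eq (hAd x) (hf.continuousOn x hx)
  have hcont : Continuous (extendFrom A f) := continuous_extendFrom hAd hlim
  refine ⟨extendFrom A f, fun x => ?_, hext⟩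
  refine mdifferentiableAt_of_punctured_nhds hcont.continuousAt ?_
  filter_upwards [hAp x] with y hy
  have hyA : A ∈ 𝓝 y := hAo.mem_nhds hy
  exact ((hf y hy).mdifferentiableAt hyA).congr_of_eventuallyEq
    (hext.eventuallyEq_of_mem hyA)

variable {x₁ : S₁} {x₂ : S₂} {H : Set G} {w : G → G} {φ : S₁ → S₂}

/-! ### Partial isometries and complete isometries -/

omit [T2Space S₁] [CompactSpace S₁] [IsManifold 𝓘(ℂ) ω S₁] [IsManifold 𝓘(ℂ) ω S₂]
  [IsManifold 𝓘(ℂ) ω T] in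
/-- A partial isometry covers the identity of the quotient. -/
theorem IsPartialIsometry.map_eq (hφ : IsPartialIsometry C π₁ π₂ x₁ x₂ H w φ)
    (hπ₁ : IsOrbifoldQuotient G m π₁) (hπ₂ : IsOrbifoldQuotient G m π₂) (hx₂ : π₂ x₂ ∉ C.graph) :
    ∀ x ∈ patch C π₁ x₁ H, π₂ (φ x) = π₁ x := by
  have h : EqOn (π₂ ∘ φ) π₁ (⋃ g ∈ H, g • openPolygon C π₁ x₁) := by
    intro x hx
    obtain ⟨g, hg, hxg⟩ := mem_iUnion₂.1 hx
    have hx' := openPolygon_subset C x₁ (mem_smul_set_iff_inv_smul_mem.1 hxg)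
    rw [Function.comp_apply, hφ.eq_on_polygons g hg x hxg, hπ₂.map_smul,
      map_polygonMap hπ₂ hx₂ hx', hπ₁.map_smul]
  refine h.of_subset_closure (hπ₂.continuous.comp_continuousOn hφ.continuousOn)
    hπ₁.continuous.continuousOn
    (iUnion₂_subset fun g hg => smul_openPolygon_subset_patch C x₁ hg) ?_
  rw [hπ₁.patch_eq]
  exact inter_subset_left

/-- A partial isometry between the full punctured surfaces is complete: the map and its inverse
extend over the vertices. -/
theorem IsPartialIsometry.isCompleteIsometry (hφ : IsPartialIsometry C π₁ π₂ x₁ x₂ H w φ)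
    (hπ₁ : IsOrbifoldQuotient G m π₁) (hπ₂ : IsOrbifoldQuotient G m π₂) (hx₂ : π₂ x₂ ∉ C.graph)
    (h₁ : patch C π₁ x₁ H = puncturedSurface C π₁)
    (h₂ : patch C π₂ x₂ (w '' H) = puncturedSurface C π₂) : IsCompleteIsometry C π₁ x₁ H φ := by
  have hmap := hφ.map_eq hπ₁ hπ₂ hx₂
  obtain ⟨ψ, hψφ, -, hψd⟩ := hφ.inverse
  have hφd := hφ.holomorphicOn
  have hbij := hφ.bijOn
  rw [IsCompleteIsometry]
  rw [h₁] at hmap hψφ hφd hbij ⊢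
  rw [h₂] at hψd hbij
  rw [(hπ₁.isOpen_puncturedSurface C).interior_eq] at hφd
  rw [(hπ₂.isOpen_puncturedSurface C).interior_eq] at hψd
  have hψ : ∀ y ∈ puncturedSurface C π₂, π₁ (ψ y) = π₂ y ∧ φ (ψ y) = y ∧
      ψ y ∈ puncturedSurface C π₁ := by
    intro y hy
    obtain ⟨x, hx, rfl⟩ := hbij.surjOn hy
    rw [hψφ hx]
    exact ⟨(hmap x hx).symm, rfl, hx⟩
  obtain ⟨Φ, hΦd, hΦ⟩ := hπ₁.exists_holomorphic_extension hπ₂ hφd hmap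
  obtain ⟨Ψ, hΨd, hΨ⟩ := hπ₂.exists_holomorphic_extension hπ₁ hψd fun y hy => (hψ y hy).1
  have hl : Ψ ∘ Φ = id := by
    refine (hΨd.continuous.comp hΦd.continuous).ext_on (hπ₁.dense_puncturedSurface C)
      continuous_id fun x hx => ?_
    rw [Function.comp_apply, hΦ hx, hΨ (hbij.mapsTo hx), hψφ hx, id]
  have hr : Φ ∘ Ψ = id := by
    refine (hΦd.continuous.comp hΨd.continuous).ext_on (hπ₂.dense_puncturedSurface C)
      continuous_id fun y hy => ?_
    rw [Function.comp_apply, hΨ hy, hΦ (hψ y hy).2.2, (hψ y hy).2.1, id]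
  exact ⟨⟨⟨Φ, Ψ, congrFun hl, congrFun hr⟩, hΦd.continuous, hΨd.continuous⟩, ⟨hΦd, hΨd⟩, hΦ⟩

omit [CompactSpace S₂] [T2Space T] [IsManifold 𝓘(ℂ) ω T] in
/-- A biholomorphic map over `T` intertwines the two actions up to an automorphism of `G`. For fixed
`g` the closed sets `{x | Φ (g • x) = a • Φ x}` cover `S₁`, so one of them has interior points, and
the identity theorem applies. -/
theorem exists_mulAut_of_map_eq [ConnectedSpace S₁] (hπ₁ : IsOrbifoldQuotient G m π₁)
    (hπ₂ : IsOrbifoldQuotient G m π₂) (hx₁ : π₁ x₁ ∉ C.graph) {Φ : S₁ ≃ₜ S₂}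
    (hΦ : IsBiholomorphic Φ) (hmap : ∀ x, π₂ (Φ x) = π₁ x) :
    ∃ α : MulAut G, ∀ (g : G) (x : S₁), Φ (g • x) = α g • Φ x := by
  have := hπ₁.continuousConstSMul
  have := hπ₂.continuousConstSMul
  have hex : ∀ g : G, ∃ a : G, ∀ x, Φ (g • x) = a • Φ x := by
    intro g
    have hcl : ∀ a : G, IsClosed {x | Φ (g • x) = a • Φ x} := fun a =>
      isClosed_eq (Φ.continuous.comp (continuous_const_smul g)) (Φ.continuous.const_smul a)
    have hcov : ⋃ a : G, {x | Φ (g • x) = a • Φ x} = univ := by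
      refine eq_univ_of_forall fun x => ?_
      obtain ⟨a, ha⟩ := (hπ₂.fibre (Φ x) (Φ (g • x))).1 (by rw [hmap, hmap, hπ₁.map_smul])
      exact mem_iUnion.2 ⟨a, ha.symm⟩
    obtain ⟨a, y, hy⟩ := nonempty_interior_of_iUnion_of_closed hcl hcov
    refine ⟨a, congrFun (eq_of_mdifferentiable_of_eventuallyEq (f := fun x => Φ (g • x))
      (g := fun x => a • Φ x) (hΦ.1.comp (hπ₁.smul_holomorphic g))
      ((hπ₂.smul_holomorphic a).comp hΦ.1) (x₀ := y) (mem_interior_iff_mem_nhds.1 hy))⟩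
  choose a ha using hex
  have hv₁ : π₁ x₁ ∉ C.vertices := fun h => hx₁ (Or.inl h)
  have hv₂ : π₂ (Φ x₁) ∉ C.vertices := by rwa [hmap]
  have hmul : ∀ g h, a (g * h) = a g * a h := fun g h =>
    hπ₂.smul_right_injective C hv₂ (by
      simp only [mul_smul]
      rw [← ha, mul_smul, ha, ha])
  have hinj : Function.Injective a := fun g h hgh =>
    hπ₁.smul_right_injective C hv₁ (Φ.injective (by simp only [ha, hgh]))
  exact ⟨MulEquiv.ofBijective (MonoidHom.mk' a hmul) (Finite.injective_iff_bijective.1 hinj), ha⟩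

omit [T2Space S₁] [CompactSpace S₁] [IsManifold 𝓘(ℂ) ω S₁] [IsManifold 𝓘(ℂ) ω S₂]
  [IsManifold 𝓘(ℂ) ω T] in
/-- An equivariant biholomorphic map over `T` restricts to a partial isometry on every patch. -/
theorem isPartialIsometry_of_equivariant
    (hπ₂ : IsOrbifoldQuotient G m π₂) (hx₁ : π₁ x₁ ∉ C.graph)
    {Φ : S₁ ≃ₜ S₂} (hΦ : IsBiholomorphic Φ) (hmap : ∀ x, π₂ (Φ x) = π₁ x) (hΦx : Φ x₁ = x₂)
    {α : MulAut G} (hα : ∀ (g : G) (x : S₁), Φ (g • x) = α g • Φ x) (K : Set G) :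
    IsPartialIsometry C π₁ π₂ x₁ x₂ K α Φ := by
  have hx₂ : π₂ x₂ ∉ C.graph := by rwa [← hΦx, hmap]
  have hpre : ∀ A : Set T, Φ '' (π₁ ⁻¹' A) = π₂ ⁻¹' A := by
    intro A
    ext y
    rw [Φ.image_eq_preimage_symm, mem_preimage, mem_preimage, mem_preimage, ← hmap,
      Φ.apply_symm_apply]
  have hopen : Φ '' openPolygon C π₁ x₁ = openPolygon C π₂ x₂ := by
    rw [openPolygon, Φ.image_connectedComponentIn hx₁, hpre, hΦx, openPolygon]
  have hnip : Φ '' nippedPolygon C π₁ x₁ = nippedPolygon C π₂ x₂ := by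
    rw [nippedPolygon, image_sdiff Φ.injective, Φ.image_closure, hopen, hpre, nippedPolygon]
  have hpatch : Φ '' patch C π₁ x₁ K = patch C π₂ x₂ (α '' K) := by
    rw [patch, image_iUnion₂, patch, biUnion_image]
    refine iUnion₂_congr fun g _ => ?_
    rw [← hnip, ← image_smul, ← image_smul, image_image, image_image]
    simp only [hα]
  refine ⟨α.injective.injOn, fun g _ x hx => ?_, ?_, Φ.continuous.continuousOn,
    hΦ.1.mdifferentiableOn, Φ.symm, fun x _ => Φ.symm_apply_apply x, Φ.symm.continuous.continuousOn,
    hΦ.2.mdifferentiableOn⟩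
  · have hx' := mem_smul_set_iff_inv_smul_mem.1 hx
    rw [polygonMap_eq hπ₂ hx₂ (hopen ▸ mem_image_of_mem Φ hx') (hmap _), ← hα, smul_inv_smul]
  · rw [← hpatch]
    exact Φ.injective.injOn.bijOn_image

omit [IsManifold 𝓘(ℂ) ω S₁] in
/-- A patch that is not everything meets a polygon outside it, because the punctured surface is
connected and patches are closed in it. -/
theorem exists_adjacent_polygon [ConnectedSpace S₁] (hπ₁ : IsOrbifoldQuotient G m π₁)
    (hx₁ : π₁ x₁ ∉ C.graph) (hH : H.Nonempty) (hne : H ≠ univ) :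
    ∃ h ∉ H, ((h • nippedPolygon C π₁ x₁) ∩ patch C π₁ x₁ H).Nonempty := by
  have hconn : IsPreconnected (puncturedSurface C π₁) :=
    isPreconnected_compl_of_finite (hπ₁.finite_preimage_vertices C)
  have hv : ∀ g : G, g • x₁ ∈ puncturedSurface C π₁ := fun g h => hx₁ (Or.inl (by
    rwa [mem_preimage, hπ₁.map_smul] at h))
  have hmem : ∀ (K : Set G), ∀ g ∈ K, g • x₁ ∈ ⋃ g ∈ K, g • openPolygon C π₁ x₁ := fun K g hg =>
    mem_biUnion hg (smul_mem_smul_set (mem_openPolygon_self C hx₁))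
  obtain ⟨g, hg⟩ := hH
  obtain ⟨h, hh⟩ := (ne_univ_iff_exists_notMem H).1 hne
  have hcover : puncturedSurface C π₁ ⊆ closure (⋃ g ∈ H, g • openPolygon C π₁ x₁) ∪
      closure (⋃ g ∈ Hᶜ, g • openPolygon C π₁ x₁) := by
    rw [← closure_union, ← biUnion_union, union_compl_self, ← hπ₁.patch_univ C hx₁, hπ₁.patch_eq]
    exact inter_subset_left
  obtain ⟨x, hx, hxH, hxH'⟩ := isPreconnected_closed_iff.1 hconn _ _ isClosed_closure
    isClosed_closure hcover ⟨g • x₁, hv g, subset_closure (hmem H g hg)⟩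
    ⟨h • x₁, hv h, subset_closure (hmem Hᶜ h hh)⟩
  have h1 : x ∈ patch C π₁ x₁ H := hπ₁.patch_eq C x₁ H ▸ ⟨hxH, hx⟩
  have h2 : x ∈ patch C π₁ x₁ Hᶜ := hπ₁.patch_eq C x₁ Hᶜ ▸ ⟨hxH', hx⟩
  obtain ⟨k, hk, hxk⟩ := mem_iUnion₂.1 h2
  exact ⟨k, hk, x, hxk, h1⟩

/-- The biholomorphic extension of a complete maximal partial isometry covers the identity of `T`
and is equivariant with respect to `w`, which is an automorphism defined on all of `G`: otherwise
the extension would enlarge the partial isometry. -/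
theorem IsMaximalPartialIsometry.exists_equivariant_of_complete [ConnectedSpace S₁]
    (hφ : IsMaximalPartialIsometry C π₁ π₂ x₁ x₂ H w φ)
    (hπ₁ : IsOrbifoldQuotient G m π₁) (hπ₂ : IsOrbifoldQuotient G m π₂)
    (hx₁ : π₁ x₁ ∉ C.graph) (hx : π₂ x₂ = π₁ x₁) (one_mem : 1 ∈ H) (w_one : w 1 = 1)
    (hc : IsCompleteIsometry C π₁ x₁ H φ) :
    H = univ ∧ ∃ (Φ : S₁ ≃ₜ S₂) (α : MulAut G), IsBiholomorphic Φ ∧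
      EqOn Φ φ (patch C π₁ x₁ H) ∧ (∀ x, π₂ (Φ x) = π₁ x) ∧ (∀ g, α g = w g) ∧
      ∀ (g : G) (x : S₁), Φ (g • x) = α g • Φ x := by
  have hx₂ : π₂ x₂ ∉ C.graph := hx ▸ hx₁
  obtain ⟨Φ, hΦ, hΦφ⟩ := hc
  have hsub := fun (g : G) (hg : g ∈ H) => smul_openPolygon_subset_patch C x₁ (π := π₁) hg
  have hpoly : ∀ g ∈ H, ∀ x ∈ openPolygon C π₁ x₁,
      Φ (g • x) = w g • polygonMap C π₁ π₂ x₂ x := by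
    intro g hg x hx
    have hgx := smul_mem_smul_set (a := g) hx
    rw [hΦφ (hsub g hg hgx), hφ.eq_on_polygons g hg _ hgx, inv_smul_smul]
  have hself := mem_openPolygon_self C hx₁
  have hmap : ∀ x, π₂ (Φ x) = π₁ x := by
    refine congrFun (eq_of_mdifferentiable_of_eventuallyEq (hπ₂.holomorphic.comp hΦ.1)
      hπ₁.holomorphic (x₀ := x₁) ?_)
    filter_upwards [(hπ₁.isOpen_openPolygon C x₁).mem_nhds hself] with x hx
    have h := hpoly 1 one_mem x hx
    rw [one_smul, w_one, one_smul] at h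
    rw [h, map_polygonMap hπ₂ hx₂ (openPolygon_subset C x₁ hx)]
  have hbase : polygonMap C π₁ π₂ x₂ x₁ = x₂ :=
    polygonMap_eq hπ₂ hx₂ (mem_openPolygon_self C hx₂) hx
  have hΦx : Φ x₁ = x₂ := by
    have h := hpoly 1 one_mem x₁ hself
    rwa [one_smul, w_one, one_smul, hbase] at h
  obtain ⟨α, hα⟩ := exists_mulAut_of_map_eq hπ₁ hπ₂ hx₁ hΦ hmap
  have hαw : EqOn α w H := by
    intro g hg
    have h := hpoly g hg x₁ hself
    rw [hα, hΦx, hbase] at h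
    exact hπ₂.smul_right_injective C (fun h' => hx₂ (Or.inl h')) h
  have hH : H = univ := by
    by_contra hne
    obtain ⟨h, hh, hadj⟩ := exists_adjacent_polygon hπ₁ hx₁ ⟨1, one_mem⟩ hne
    exact hφ.maximal h hh hadj α hαw
      ⟨Φ, isPartialIsometry_of_equivariant hπ₂ hx₁ hΦ hmap hΦx hα _⟩
  exact ⟨hH, Φ, α, hΦ, hΦφ, hmap, fun g => hαw (hH ▸ mem_univ g), hα⟩

end TwoSurfaces

/-! ### Isomorphisms of Cayley graphs -/

section CayleyIso

variable {G S₁ S₂ T : Type*} [Group G] [TopologicalSpace S₁] [TopologicalSpace S₂]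
  [TopologicalSpace T] [ChartedSpace ℂ T] [MulAction G S₁] [MulAction G S₂] {m : T → ℕ}
  {C : CutSystem m} {z₀ : T} {D : CrossoverSystem C z₀} {π₁ : S₁ → T} {π₂ : S₂ → T}
  {x₁ : S₁} {x₂ : S₂}

/-- An automorphism matching the crossover transformations is an isomorphism of the standard Cayley
graphs. -/
def groupCayleyIso (α : MulAut G)
    (hα : ∀ j, α (crossover G D π₁ x₁ j) = crossover G D π₂ x₂ j) :
    groupCayley G D π₁ x₁ ≃g groupCayley G D π₂ x₂ where
  toEquiv := α.toEquiv
  map_rel_iff' := by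
    intro g h
    simp only [groupCayley, SimpleGraph.fromRel_adj, ← hα, MulEquiv.toEquiv_eq_coe,
      MulEquiv.coe_toEquiv, ← map_mul, α.injective.eq_iff, α.injective.ne_iff]

/-- An automorphism matching the crossover transformations is the vertex map of an isomorphism of
the modified Cayley graphs. -/
def modifiedCayleyIso (α : MulAut G)
    (hα : ∀ j, α (crossover G D π₁ x₁ j) = crossover G D π₂ x₂ j) :
    (modifiedCayley G D π₁ x₁).Iso (modifiedCayley G D π₂ x₂) where
  vert := α.toEquiv
  edge := (Equiv.refl _).prodCongr α.toEquiv
  source_edge _ := rfl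
  target_edge a := by simp [modifiedCayley, hα]
  op_edge a := by simp [modifiedCayley, hα]
  colour_edge _ := rfl

/-- A homeomorphism over `T` carries lifts of the crossover loops to lifts of the crossover
loops. -/
def dualCayleyIso (Φ : S₁ ≃ₜ S₂) (hΦ : ∀ x, π₂ (Φ x) = π₁ x) :
    (dualCayley D π₁).Iso (dualCayley D π₂) where
  vert := Φ.toEquiv.subtypeEquiv fun x => by simp [hΦ]
  edge :=
    { toFun := fun a => ⟨(a.1.1, (Φ : C(S₁, S₂)).comp a.1.2), fun t => by
        simpa [hΦ] using a.2 t⟩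
      invFun := fun a => ⟨(a.1.1, (Φ.symm : C(S₂, S₁)).comp a.1.2), fun t => by
        simpa [← hΦ] using a.2 t⟩
      left_inv := fun a => by
        apply Subtype.ext
        apply Prod.ext
        · rfl
        · ext t
          simp
      right_inv := fun a => by
        apply Subtype.ext
        apply Prod.ext
        · rfl
        · ext t
          simp }
  source_edge _ := rfl
  target_edge _ := rfl
  op_edge _ := rfl
  colour_edge _ := rfl

end CayleyIso

end ModularCompanions

/-! ### Completeness of maximal partial isometries -/

theorem mainTheorem2 {G S₁ S₂ T : Type*} [Group G] [Finite G]
    [TopologicalSpace S₁] [T2Space S₁] [CompactSpace S₁] [ConnectedSpace S₁]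
    [ChartedSpace ℂ S₁] [IsManifold 𝓘(ℂ) ω S₁] [MulAction G S₁]
    [TopologicalSpace S₂] [T2Space S₂] [CompactSpace S₂] [ConnectedSpace S₂]
    [ChartedSpace ℂ S₂] [IsManifold 𝓘(ℂ) ω S₂] [MulAction G S₂]
    [TopologicalSpace T] [T2Space T] [CompactSpace T] [ConnectedSpace T]
    [ChartedSpace ℂ T] [IsManifold 𝓘(ℂ) ω T]
    -- the common quotient orbifold `(T, m)` of the two actions
    (m : T → ℕ) (π₁ : S₁ → T) (π₂ : S₂ → T)
    (hπ₁ : ModularCompanions.IsOrbifoldQuotient G m π₁)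
    (hπ₂ : ModularCompanions.IsOrbifoldQuotient G m π₂)
    -- a cut system on `T`, crossover loops based at `z₀`, and lifts of `z₀` which select the
    -- distinguished polygons
    (C : ModularCompanions.CutSystem m) (z₀ : T) (D : ModularCompanions.CrossoverSystem C z₀)
    (x₁ : S₁) (hx₁ : π₁ x₁ = z₀) (x₂ : S₂) (hx₂ : π₂ x₂ = z₀)
    -- the assignment `w : H → H' = w(H)`
    (H : Set G) (w : G → G) (one_mem : 1 ∈ H)
    (crossover_mem : ∀ j, ModularCompanions.crossover G D π₁ x₁ j ∈ H)
    (w_inj : Set.InjOn w H) (w_one : w 1 = 1)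
    (w_crossover : ∀ j, w (ModularCompanions.crossover G D π₁ x₁ j) =
      ModularCompanions.crossover G D π₂ x₂ j)
    -- the maximal partial isometry determined by `w`
    (φ : S₁ → S₂)
    (hφ : ModularCompanions.IsMaximalPartialIsometry C π₁ π₂ x₁ x₂ H w φ) :
    (ModularCompanions.IsCompleteIsometry C π₁ x₁ H φ ↔
      H = Set.univ ∧ ∃ α : MulAut G, ∀ g, α g = w g) ∧
    (ModularCompanions.IsCompleteIsometry C π₁ x₁ H φ ↔
      ModularCompanions.patch C π₁ x₁ H = ModularCompanions.puncturedSurface C π₁ ∧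
      ModularCompanions.patch C π₂ x₂ (w '' H) = ModularCompanions.puncturedSurface C π₂) ∧
    (ModularCompanions.IsCompleteIsometry C π₁ x₁ H φ →
      ∃ (Φ : S₁ ≃ₜ S₂) (α : MulAut G),
        ModularCompanions.IsBiholomorphic Φ ∧
        Set.EqOn Φ φ (ModularCompanions.patch C π₁ x₁ H) ∧
        (∀ x, π₂ (Φ x) = π₁ x) ∧
        (∀ g, α g = w g) ∧
        (∀ (g : G) (x : S₁), Φ (g • x) = α g • Φ x) ∧
        (∃ F : ModularCompanions.groupCayley G D π₁ x₁ ≃g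
            ModularCompanions.groupCayley G D π₂ x₂, ∀ g, F g = w g) ∧
        (∃ F : (ModularCompanions.modifiedCayley G D π₁ x₁).Iso
            (ModularCompanions.modifiedCayley G D π₂ x₂), ∀ g, F.vert g = w g) ∧
        (∃ F : (ModularCompanions.dualCayley D π₁).Iso (ModularCompanions.dualCayley D π₂),
          (∀ v, (F.vert v : S₂) = Φ v) ∧ ∀ a t, (F.edge a).1.2 t = Φ (a.1.2 t))) := by
  have hz₁ : π₁ x₁ ∉ C.graph := hx₁ ▸ D.base_notMem
  have hz₂ : π₂ x₂ ∉ C.graph := hx₂ ▸ D.base_notMem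
  have hcomplete := hφ.exists_equivariant_of_complete hπ₁ hπ₂ hz₁ (hx₂.trans hx₁.symm) one_mem w_one
  have hfull : H = Set.univ → w '' H = Set.univ →
      ModularCompanions.patch C π₁ x₁ H = ModularCompanions.puncturedSurface C π₁ ∧
      ModularCompanions.patch C π₂ x₂ (w '' H) = ModularCompanions.puncturedSurface C π₂ := by
    intro h₁ h₂
    rw [h₂, h₁]
    exact ⟨hπ₁.patch_univ C hz₁, hπ₂.patch_univ C hz₂⟩
  have haut : (H = Set.univ ∧ ∃ α : MulAut G, ∀ g, α g = w g) →
      ModularCompanions.patch C π₁ x₁ H = ModularCompanions.puncturedSurface C π₁ ∧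
      ModularCompanions.patch C π₂ x₂ (w '' H) = ModularCompanions.puncturedSurface C π₂ := by
    rintro ⟨hH, α, hα⟩
    refine hfull hH ?_
    rw [hH, Set.image_univ, Set.range_eq_univ, ← funext hα]
    exact α.surjective
  have hpatch := fun h : ModularCompanions.patch C π₁ x₁ H =
      ModularCompanions.puncturedSurface C π₁ ∧
      ModularCompanions.patch C π₂ x₂ (w '' H) = ModularCompanions.puncturedSurface C π₂ =>
    hφ.toIsPartialIsometry.isCompleteIsometry hπ₁ hπ₂ hz₂ h.1 h.2
  have hforward : ModularCompanions.IsCompleteIsometry C π₁ x₁ H φ →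
      H = Set.univ ∧ ∃ α : MulAut G, ∀ g, α g = w g := fun hc => by
    obtain ⟨hH, -, α, -, -, -, hα, -⟩ := hcomplete hc
    exact ⟨hH, α, hα⟩
  refine ⟨⟨hforward, fun h => hpatch (haut h)⟩, ⟨fun hc => haut (hforward hc), hpatch⟩,
    fun hc => ?_⟩
  obtain ⟨-, Φ, α, hΦ, hΦφ, hmap, hαw, hα⟩ := hcomplete hc
  have hτ : ∀ j, α (ModularCompanions.crossover G D π₁ x₁ j) =
      ModularCompanions.crossover G D π₂ x₂ j := fun j => by rw [hαw, w_crossover]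
  exact ⟨Φ, α, hΦ, hΦφ, hmap, hαw, hα, ⟨ModularCompanions.groupCayleyIso α hτ, hαw⟩,
    ⟨ModularCompanions.modifiedCayleyIso α hτ, hαw⟩,
    ⟨ModularCompanions.dualCayleyIso Φ hmap, fun _ => rfl, fun _ _ => rfl⟩⟩
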